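/- **Setting.** For odd $m$ let $M_m(q)=\sum_{k>m/2}\binom mk q^k(1-q)^{m-k}$ be the probability that a majority of $m$ independent voters, each correct with probability $q$, is correct. For parameters $q_b,q_w$ and $p=(p_w,p_b^0,p_b^1)$ let the gap indicator $G(q_b,q_w,p)$ be the random variable with values in $\{1,-1,0\}$ and $$\Pr(G=1)=q_b(1-p_w)p_b^0+(1-q_w)p_w(1-p_b^1),\qquad \Pr(G=-1)=(1-q_b)(1-p_w)p_b^0+q_wp_w(1-p_b^1).$$ A *labeling problem* consists of a probability distribution $\mathcal D$ of data points $x$ with true binary labels $y_{\mathrm{True}}(x)$, a probability distribution of crowdworkers $l$ who provide binary labels $y_l(x)$, and two binary classifiers $c_b,c_w$. Put $q(x)=\Pr_l(y_l(x)=y_{\mathrm{True}}(x))$, and let $E_b$ (resp. $E_w$) be the event that $c_b$ is correct and $c_w$ is not (resp. that $c_w$ is correct and $c_b$ is not). The problem *has parameters* $(q_b,q_w,p)$ if $c_w$ is correct with probability $p_w$, $c_b$ is correct with conditional probability $p_b^0$ given that $c_w$ is incorrect and $p_b^1$ given that $c_w$ is correct, $\mathbb E_x[q(x)\mid E_b]=q_b$,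 and $\mathbb E_x[q(x)\mid E_w]=q_w$ (no condition if $\Pr(E_w)=0$). A test set with $n$ data points and $m$ labels each consists of $n$ independent data points $x\sim\mathcal D$; for each of them $m$ crowdworkers are drawn independently, and the test label $y_{\mathrm{Test}}$ of $x$ is the majority of their labels. The gap indicator of a data point is $1$ if $c_b(x)=y_{\mathrm{Test}}\ne c_w(x)$, $-1$ if $c_w(x)=y_{\mathrm{Test}}\neq c_b(x)$, and $0$ if $c_b(x)=c_w(x)$. The *success probability* is the probability that the sum of the $n$ gap indicators is positive, i.e. that $c_b$ has strictly higher test accuracy than $c_w$. **Theorem.** Let $m>1$ be odd, $q_b,q_w\in(\tfrac12,1]$ with $q_b\ge q_w$, and $p_w,p_b^0,p_b^1\in[\tfrac12,1]$ with $(1-p_w)p_b^0+p_wp_b^1>p_w$. Then there is an $N\in\mathbb N$, depending only on $m,q_b,q_w,p_w,p_b^0,p_b^1$, such that for all $n>N$: 1. for independent copies $G_i$ of the gap indicators, $$\Pr\Big(\sum_{i=1}^nG_i(M_m(q_b),M_m(q_w),p)>0\Big)<\Pr\Big(\sum_{i=1}^{mn}G_i(q_b,q_w,p)>0\Big);$$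 2. for every labeling problem with parameters $(q_b,q_w,p)$, with possibly heterogeneous label accuracies $q(x)$, that satisfies $$(1-p_w)p_b^0\big(M_m(q_b)-\mathbb E_x[M_m(q(x))\mid E_b]\big)\ \ge\ p_w(1-p_b^1)\big(M_m(q_w)-\mathbb E_x[M_m(q(x))\mid E_w]\big)$$ (no biased heterogeneity; the right-hand side is $0$ if $\Pr(E_w)=p_w(1-p_b^1)=0$), the success probability with $n$ data points and $m$ labels each is strictly smaller than the success probability with $mn$ data points and a single label each. -/

import Mathlib

open MeasureTheory ProbabilityTheory

noncomputable section

/-- Probability `M_m(q)` that a strict majority of `m` independent voters is correct, when each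
voter is correct with probability `q`. -/
def majorityAccuracy (m : ℕ) (q : ℝ) : ℝ :=
  ∑ k ∈ (Finset.range (m + 1)).filter (fun k => m < 2 * k),
    (m.choose k : ℝ) * q ^ k * (1 - q) ^ (m - k)

/-- The law of the gap indicator `G(q, p)` of the correlated model, with label accuracies
`q_b`, `q_w` and classifier parameters `p_w`, `p_b^0`, `p_b^1`. -/
def gapLaw (qb qw pw pb0 pb1 : ℝ) : Measure ℤ :=
  ENNReal.ofReal (qb * ((1 - pw) * pb0) + (1 - qw) * (pw * (1 - pb1))) • Measure.dirac 1
    + ENNReal.ofReal ((1 - qb) * ((1 - pw) * pb0) + qw * (pw * (1 - pb1))) • Measure.dirac (-1)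
    + ENNReal.ofReal (1 - (1 - pw) * pb0 - pw * (1 - pb1)) • Measure.dirac 0

/-- `Pr(∑ i, G i > 0)` for `n` independent copies `G i` of a random variable with law `μ`. -/
def sumPosProb (μ : Measure ℤ) (n : ℕ) : ℝ :=
  (Measure.pi (fun _ : Fin n => μ)).real {g | 0 < ∑ i, g i}

/-- A binary labeling problem: a population of data points `X`, a population of crowdworkers `L`,
the true labels, the labels provided by the crowdworkers, and a better and a worse classifier. -/
structure LabelingModel (X L : Type*) [MeasurableSpace X] [MeasurableSpace L] where
  dist : Measure X
  isProb_dist : IsProbabilityMeasure dist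
  crowd : Measure L
  isProb_crowd : IsProbabilityMeasure crowd
  yTrue : X → Bool
  measurable_yTrue : Measurable yTrue
  label : L → X → Bool
  measurable_label : Measurable (fun z : L × X => label z.1 z.2)
  cb : X → Bool
  measurable_cb : Measurable cb
  cw : X → Bool
  measurable_cw : Measurable cw

/-- The majority of the binary votes `v` (used for an odd number of votes, so without ties). -/
def majorityVote {m : ℕ} (v : Fin m → Bool) : Bool :=
  decide (m < 2 * (Finset.univ.filter (fun j => v j = true)).card)

namespace LabelingModel

variable {X L : Type*} [MeasurableSpace X] [MeasurableSpace L]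

/-- The accuracy `q(x)` of a random crowdworker on the data point `x`. -/
def labelAccuracy (P : LabelingModel X L) (x : X) : ℝ :=
  P.crowd.real {l | P.label l x = P.yTrue x}

/-- The event `E_b`: the better classifier is correct and the worse one is incorrect. -/
def eventB (P : LabelingModel X L) : Set X :=
  {x | P.cb x = P.yTrue x ∧ P.cw x ≠ P.yTrue x}

/-- The event `E_w`: the better classifier is incorrect and the worse one is correct. -/
def eventW (P : LabelingModel X L) : Set X :=
  {x | P.cb x ≠ P.yTrue x ∧ P.cw x = P.yTrue x}

/-- The gap indicator on a data point `x` that is labeled by the crowdworkers `l 0, …, l (m - 1)`,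
the test label being the majority of the labels they provide. -/
def gap (P : LabelingModel X L) {m : ℕ} (x : X) (l : Fin m → L) : ℤ :=
  let yTest := majorityVote (fun j => P.label (l j) x)
  if P.cb x = yTest ∧ P.cw x ≠ yTest then 1
  else if P.cw x = yTest ∧ P.cb x ≠ yTest then -1
  else 0

/-- The probability that the sum of gap indicators is positive (the better classifier has strictly
higher test accuracy) on a test set of `n` independent data points, each of which is labeled by the
majority vote of `m` independently drawn crowdworkers. -/
def successProb (P : LabelingModel X L) (m n : ℕ) : ℝ :=
  (Measure.pi (fun _ : Fin n => P.dist.prod (Measure.pi (fun _ : Fin m => P.crowd)))).real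
    {ω | 0 < ∑ i, P.gap (ω i).1 (ω i).2}

/-- The labeling problem has classifier parameters `p_w`, `p_b^0`, `p_b^1` and (average) label
accuracies `q_b` given `E_b` and `q_w` given `E_w`. If `E_w` is a null event there is no conditional
label accuracy given `E_w`, and `q_w` is unconstrained. -/
structure HasParameters (P : LabelingModel X L) (qb qw pw pb0 pb1 : ℝ) : Prop where
  pw_eq : P.dist.real {x | P.cw x = P.yTrue x} = pw
  pb0_eq : (P.dist[|{x | P.cw x ≠ P.yTrue x}]).real {x | P.cb x = P.yTrue x} = pb0
  pb1_eq : (P.dist[|{x | P.cw x = P.yTrue x}]).real {x | P.cb x = P.yTrue x} = pb1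
  qb_eq : ∫ x, P.labelAccuracy x ∂(P.dist[|P.eventB]) = qb
  qw_eq : P.dist P.eventW ≠ 0 → ∫ x, P.labelAccuracy x ∂(P.dist[|P.eventW]) = qw

/-- No biased heterogeneity, with the denominator `p_w (1 - p_b^1)` (the probability of `E_w`)
cleared, so that the condition also makes sense when `E_w` is a null event. -/
def NoBiasedHeterogeneity (P : LabelingModel X L) (m : ℕ) (qb qw pw pb0 pb1 : ℝ) : Prop :=
  pw * (1 - pb1) *
      (majorityAccuracy m qw - ∫ x, majorityAccuracy m (P.labelAccuracy x) ∂(P.dist[|P.eventW]))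
    ≤ (1 - pw) * pb0 *
      (majorityAccuracy m qb - ∫ x, majorityAccuracy m (P.labelAccuracy x) ∂(P.dist[|P.eventB]))

end LabelingModel

end

/-! A gap indicator is nonzero exactly when the classifiers disagree, whatever the labels are. The
sum of gap indicators is therefore a lazy walk on `ℤ` whose moving probability `s = a + b`, with `a
= (1 - pw) * pb0` and `b = pw * (1 - pb1)`, is the same for both ways of spending labels; only the
probability of moving up differs. For single labels it is `s * q`, where `q > 1 / 2` is an effective
accuracy.

With majority labels, the up-probability is at most `s * M`, where `M = majorityAccuracy m q`
(`majorityAccuracy_mixture_le`), so by stochastic comparison (`walkFailure_anti`) the failure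
probability is at least that of the walk with accuracy `M`. The failure of a walk with accuracy `t`
has exponential rate `2 * s * √(t * (1 - t)) + (1 - s)`, by a Chernoff bound (`walkFailure_le`) and
a matching lower bound (`exists_pow_le_walkFailure`). It remains to compare rates. With `y = 2 * √(q
* (1 - q))`, Cauchy–Schwarz gives `y ^ m ≤ 2 * √(M * (1 - M))`, and strict convexity of the power
gives `(s * y + (1 - s)) ^ m < s * y ^ m + (1 - s)`. The laziness `1 - s > 0` is what makes single
labels strictly better.

Single labels see only average accuracies, and the absence of biased heterogeneity bounds the
majority up-probability by its homogeneous value. All cases are thus compared with the same two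
walks, which makes `N` uniform. -/

/-! ### Lazy random walks on the integers -/

/-- The transition operator of the walk on `ℤ` that moves up with probability `u`, down with
probability `v`, and otherwise stays. -/
noncomputable def walkStep (u v : ℝ) (f : ℤ → ℝ) (x : ℤ) : ℝ :=
  u * f (x + 1) + v * f (x - 1) + (1 - u - v) * f x

section WalkStep

variable {u v : ℝ}

theorem walkStep_mono (hu : 0 ≤ u) (hv : 0 ≤ v) (huv : u + v ≤ 1) : Monotone (walkStep u v) := by
  intro f g hfg x
  have h0 : 0 ≤ 1 - u - v := by linarith
  have h1 := hfg (x + 1)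
  have h2 := hfg (x - 1)
  have h3 := hfg x
  simp only [walkStep]
  gcongr

theorem walkStep_smul (c : ℝ) (f : ℤ → ℝ) : walkStep u v (c • f) = c • walkStep u v f := by
  ext x
  simp only [walkStep, Pi.smul_apply, smul_eq_mul]
  ring

theorem iterate_walkStep_smul (c : ℝ) (f : ℤ → ℝ) (n : ℕ) :
    (walkStep u v)^[n] (c • f) = c • (walkStep u v)^[n] f := by
  induction n with
  | zero => rfl
  | succ n ih => rw [Function.iterate_succ_apply', ih, walkStep_smul, Function.iterate_succ_apply']

theorem iterate_walkStep_one_sub (f : ℤ → ℝ) (n : ℕ) (x : ℤ) :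
    (walkStep u v)^[n] (fun y => 1 - f y) x = 1 - (walkStep u v)^[n] f x := by
  induction n generalizing x with
  | zero => rfl
  | succ n ih =>
    simp only [Function.iterate_succ_apply', walkStep, ih]
    ring

/-- Supersolutions give upper bounds on iterates because the operator is monotone and homogeneous;
`pow_le_iterate_walkStep` is the mirror image for subsolutions. -/
theorem iterate_walkStep_le_pow (hu : 0 ≤ u) (hv : 0 ≤ v) (huv : u + v ≤ 1) {c : ℝ}
    {f : ℤ → ℝ} (hf : walkStep u v f ≤ c • f) (hc : 0 ≤ c) (n : ℕ) :
    (walkStep u v)^[n] f ≤ c ^ n • f := by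
  induction n with
  | zero => simp
  | succ n ih =>
    rw [Function.iterate_succ_apply', pow_succ, mul_smul]
    refine (walkStep_mono hu hv huv ih).trans ?_
    rw [walkStep_smul]
    exact smul_le_smul_of_nonneg_left hf (pow_nonneg hc n)

theorem pow_le_iterate_walkStep (hu : 0 ≤ u) (hv : 0 ≤ v) (huv : u + v ≤ 1) {c : ℝ}
    {f : ℤ → ℝ} (hf : c • f ≤ walkStep u v f) (hc : 0 ≤ c) (n : ℕ) :
    c ^ n • f ≤ (walkStep u v)^[n] f := by
  induction n with
  | zero => simp
  | succ n ih =>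
    rw [Function.iterate_succ_apply', pow_succ, mul_smul]
    refine le_trans ?_ (walkStep_mono hu hv huv ih)
    rw [walkStep_smul]
    exact smul_le_smul_of_nonneg_left hf (pow_nonneg hc n)

theorem Monotone.walkStep {f : ℤ → ℝ} (hf : Monotone f) (hu : 0 ≤ u) (hv : 0 ≤ v)
    (huv : u + v ≤ 1) : Monotone (walkStep u v f) := by
  intro x y hxy
  have h0 : 0 ≤ 1 - u - v := by linarith
  have h1 := hf (show x + 1 ≤ y + 1 by lia)
  have h2 := hf (show x - 1 ≤ y - 1 by lia)
  have h3 := hf hxy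
  simp only [_root_.walkStep]
  gcongr

/-- Shifting probability from down-steps to up-steps moves the walk up stochastically. -/
theorem iterate_walkStep_le_iterate {u' v' : ℝ} (hu : 0 ≤ u) (hv : 0 ≤ v) (huv : u + v ≤ 1)
    (hu' : 0 ≤ u') (hv' : 0 ≤ v') (hsum : u + v = u' + v') (hle : u ≤ u')
    {f : ℤ → ℝ} (hf : Monotone f) (n : ℕ) :
    (walkStep u v)^[n] f ≤ (walkStep u' v')^[n] f := by
  have hmono : ∀ n, Monotone ((walkStep u v)^[n] f) := by
    intro n
    induction n with
    | zero => exact hf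
    | succ n ih => rw [Function.iterate_succ_apply']; exact ih.walkStep hu hv huv
  induction n with
  | zero => rfl
  | succ n ih =>
    rw [Function.iterate_succ_apply', Function.iterate_succ_apply']
    refine le_trans (fun x => ?_) (walkStep_mono hu' hv' (hsum ▸ huv) ih)
    -- The two operators differ at `x` by `(u' - u)` times the increment from `x - 1` to `x + 1`.
    have h := hmono n (show x - 1 ≤ x + 1 by lia)
    simp only [walkStep]
    have hv'' : v' = u + v - u' := by linarith
    subst hv''
    nlinarith

/-! ### Exponential bounds for the failure probability -/

/-- The probability that the walk started at `0` is not positive after `n` steps. -/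
noncomputable def walkFailure (u v : ℝ) (n : ℕ) : ℝ :=
  (walkStep u v)^[n] (fun x => if x ≤ 0 then 1 else 0) 0

theorem walkFailure_anti {u' v' : ℝ} (hu : 0 ≤ u) (hv : 0 ≤ v) (huv : u + v ≤ 1)
    (hu' : 0 ≤ u') (hv' : 0 ≤ v') (hsum : u + v = u' + v') (hle : u ≤ u') (n : ℕ) :
    walkFailure u' v' n ≤ walkFailure u v n := by
  have hmono : Monotone (fun x : ℤ => if 0 < x then (1 : ℝ) else 0) := by
    intro x y hxy
    dsimp only
    split_ifs <;> first | lia | norm_num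
  have h := iterate_walkStep_le_iterate hu hv huv hu' hv' hsum hle hmono n 0
  have hf : (fun x : ℤ => if x ≤ 0 then (1 : ℝ) else 0)
      = fun x => 1 - if 0 < x then 1 else 0 := by
    ext x
    split_ifs <;> first | lia | norm_num
  rw [walkFailure, walkFailure, hf, iterate_walkStep_one_sub, iterate_walkStep_one_sub]
  linarith

/-- Exponential Markov inequality: `z ^ x` dominates the indicator of `x ≤ 0` and is an
eigenfunction of the step operator. -/
theorem walkFailure_le_of_tilt (hu : 0 ≤ u) (hv : 0 ≤ v) (huv : u + v ≤ 1) {z : ℝ} (hz : 0 < z)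
    (hz1 : z ≤ 1) (n : ℕ) : walkFailure u v n ≤ (u * z + v * z⁻¹ + (1 - u - v)) ^ n := by
  have hf : (fun x : ℤ => if x ≤ 0 then (1 : ℝ) else 0) ≤ fun x => z ^ x := by
    intro x
    dsimp only
    split_ifs with hx
    · exact one_le_zpow_of_nonpos₀ hz hz1 hx
    · positivity
  have hT : walkStep u v (fun x => z ^ x)
      ≤ (u * z + v * z⁻¹ + (1 - u - v)) • (fun x : ℤ => z ^ x) := by
    intro x
    simp only [walkStep, Pi.smul_apply, smul_eq_mul]
    rw [zpow_add_one₀ hz.ne', zpow_sub_one₀ hz.ne']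
    apply le_of_eq
    ring
  have h0 : 0 ≤ 1 - u - v := by linarith
  have h1 := (walkStep_mono hu hv huv).iterate n hf 0
  have h2 := iterate_walkStep_le_pow hu hv huv hT (by positivity) n 0
  have h3 := h1.trans h2
  simpa [walkFailure] using h3

/-- Chernoff bound for the lazy walk. -/
theorem walkFailure_le (hu : 0 < u) (hv : 0 ≤ v) (huv : u + v ≤ 1) (hvu : v ≤ u) (n : ℕ) :
    walkFailure u v n ≤ (2 * √(u * v) + (1 - u - v)) ^ n := by
  rcases hv.eq_or_lt with rfl | hv
  -- For `v = 0` the optimal tilt would be `z = 0`, which is not admissible, so the bound is reached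
  -- as `z → 0+`.
  · have hlim : Filter.Tendsto (fun z : ℝ => (u * z + (1 - u)) ^ n) (nhdsWithin 0 (Set.Ioi 0))
        (nhds ((u * 0 + (1 - u)) ^ n)) :=
      ((continuous_const.mul continuous_id).add continuous_const |>.pow n).continuousWithinAt
    have := ge_of_tendsto hlim (b := walkFailure u 0 n) ?_
    · simpa using this
    · filter_upwards [Ioc_mem_nhdsGT (show (0 : ℝ) < 1 by norm_num)] with z hz
      simpa using walkFailure_le_of_tilt hu.le le_rfl huv hz.1 hz.2 n
  · have hsu := Real.sqrt_pos.2 hu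
    have hsv := Real.sqrt_pos.2 hv
    -- This `z` minimises `u * z + v * z⁻¹`; the drift condition `v ≤ u` makes it at most `1`.
    have h := walkFailure_le_of_tilt hu.le hv.le huv (z := √v / √u) (by positivity)
      ((div_le_one hsu).2 (Real.sqrt_le_sqrt hvu)) n
    have e1 : u * (√v / √u) = √(u * v) := by
      rw [Real.sqrt_mul hu.le]
      nth_rewrite 1 [← Real.mul_self_sqrt hu.le]
      field_simp
    have e2 : v * (√v / √u)⁻¹ = √(u * v) := by
      rw [Real.sqrt_mul hu.le]
      nth_rewrite 1 [← Real.mul_self_sqrt hv.le]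
      field_simp
    rw [e1, e2] at h
    calc _ ≤ _ := h
      _ = _ := by ring

/-- Kill the walk at `1` and at `1 - L`. The factor `z ^ x` symmetrises the step, and the sine is
then the Dirichlet eigenfunction on the interval. Cut off outside, it is a subsolution supported on
nonpositive sites, so a multiple of it lies below the indicator of failure. -/
theorem pow_le_walkFailure_of_cos (hu : 0 < u) (hv : 0 < v) (huv : u + v ≤ 1) {L : ℕ}
    (hL : 2 ≤ L) (h0 : 0 ≤ 2 * √(u * v) * Real.cos (Real.pi / L) + (1 - u - v)) :
    ∃ c > 0, ∀ n, c * (2 * √(u * v) * Real.cos (Real.pi / L) + (1 - u - v)) ^ n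
      ≤ walkFailure u v n := by
  set θ := Real.pi / L with hθ
  set ρ := 2 * √(u * v) * Real.cos θ + (1 - u - v) with hρ
  have hL0 : (0 : ℝ) < L := by positivity
  have hLθ : L * θ = Real.pi := by rw [hθ]; field_simp
  have hsu := Real.sqrt_pos.2 hu
  have hsv := Real.sqrt_pos.2 hv
  set z := √v / √u with hz
  have hz0 : 0 < z := by positivity
  have e1 : u * z = √(u * v) := by
    rw [Real.sqrt_mul hu.le, hz]
    nth_rewrite 1 [← Real.mul_self_sqrt hu.le]
    field_simp
  have e2 : v * z⁻¹ = √(u * v) := by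
    rw [Real.sqrt_mul hu.le, hz]
    nth_rewrite 1 [← Real.mul_self_sqrt hv.le]
    field_simp
  let k : ℤ → ℝ := fun x => z ^ x * Real.sin (θ * (1 - x))
  let f : ℤ → ℝ := fun x => if 1 - L ≤ x ∧ x ≤ 1 then k x else 0
  have hk : ∀ x, walkStep u v k x = ρ * k x := by
    intro x
    simp only [walkStep, k]
    rw [zpow_add_one₀ hz0.ne', zpow_sub_one₀ hz0.ne']
    have s1 : Real.sin (θ * (1 - ((x + 1 : ℤ) : ℝ)))
        = Real.sin (θ * (1 - x)) * Real.cos θ - Real.cos (θ * (1 - x)) * Real.sin θ := by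
      rw [← Real.sin_sub]; congr 1; push_cast; ring
    have s2 : Real.sin (θ * (1 - ((x - 1 : ℤ) : ℝ)))
        = Real.sin (θ * (1 - x)) * Real.cos θ + Real.cos (θ * (1 - x)) * Real.sin θ := by
      rw [← Real.sin_add]; congr 1; push_cast; ring
    rw [s1, s2]
    calc _ = z ^ x * ((u * z) * (Real.sin (θ * (1 - x)) * Real.cos θ
              - Real.cos (θ * (1 - x)) * Real.sin θ)
            + (v * z⁻¹) * (Real.sin (θ * (1 - x)) * Real.cos θ
              + Real.cos (θ * (1 - x)) * Real.sin θ)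
            + (1 - u - v) * Real.sin (θ * (1 - x))) := by ring
      _ = _ := by rw [e1, e2, hρ]; ring
  have hk_one : k 1 = 0 := by simp [k]
  have hk_left : k (1 - L) = 0 := by simp [k, mul_comm θ, hLθ]
  have hk_nonneg : ∀ x : ℤ, 1 - (L : ℤ) ≤ x → x ≤ 1 → 0 ≤ k x := by
    intro x hx1 hx2
    have hθ0 : 0 ≤ θ := by positivity
    have hx1' : 1 - (x : ℝ) ≤ L := by
      have : (((1 - L : ℤ)) : ℝ) ≤ x := by exact_mod_cast hx1
      push_cast at this
      linarith
    have hx2' : 0 ≤ 1 - (x : ℝ) := by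
      have : (x : ℝ) ≤ 1 := by exact_mod_cast hx2
      linarith
    refine mul_nonneg (by positivity) (Real.sin_nonneg_of_nonneg_of_le_pi (by positivity) ?_)
    rw [← hLθ, mul_comm]
    gcongr
  have hf_nonneg : 0 ≤ f := by
    intro x
    simp only [f, Pi.zero_apply]
    split_ifs with hx
    · exact hk_nonneg x hx.1 hx.2
    · exact le_rfl
  -- Strictly inside the interval both neighbours belong to it, so the cutoff is not felt; elsewhere
  -- `f` vanishes and the right side is nonnegative.
  have hstep : ρ • f ≤ walkStep u v f := by
    intro x
    have hnonneg : 0 ≤ walkStep u v f x := by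
      have h1 := hf_nonneg (x + 1)
      have h2 := hf_nonneg (x - 1)
      have h3 := hf_nonneg x
      have h4 : 0 ≤ 1 - u - v := by linarith
      simp only [Pi.zero_apply] at h1 h2 h3
      simp only [walkStep]
      positivity
    have hzero : f x = 0 → (ρ • f) x ≤ walkStep u v f x := by
      intro h
      rw [Pi.smul_apply, h, smul_zero]
      exact hnonneg
    by_cases hx : 1 - L ≤ x ∧ x ≤ 1
    · by_cases hx1 : x = 1
      · exact hzero (by simp [f, hx1, hk_one])
      by_cases hx2 : x = 1 - L
      · exact hzero (by simp [f, hx2, hk_left])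
      have g1 : f (x + 1) = k (x + 1) := if_pos (by lia)
      have g2 : f (x - 1) = k (x - 1) := if_pos (by lia)
      have g3 : f x = k x := if_pos hx
      have := hk x
      simp only [walkStep, Pi.smul_apply, smul_eq_mul, g1, g2, g3] at this ⊢
      exact this.ge
    · exact hzero (if_neg hx)
  obtain ⟨C, hC0, hC⟩ : ∃ C > 0, ∀ x, f x ≤ C := by
    refine ⟨∑ x ∈ Finset.Icc (1 - (L : ℤ)) 1, f x + 1, ?_, fun x => ?_⟩
    · have := Finset.sum_nonneg fun x (_ : x ∈ Finset.Icc (1 - (L : ℤ)) 1) => hf_nonneg x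
      linarith
    · by_cases hx : x ∈ Finset.Icc (1 - (L : ℤ)) 1
      · have := Finset.single_le_sum (f := f) (fun y _ => hf_nonneg y) hx
        linarith
      · have h0 : f x = 0 := if_neg (by simpa using hx)
        have := Finset.sum_nonneg fun x (_ : x ∈ Finset.Icc (1 - (L : ℤ)) 1) => hf_nonneg x
        linarith
  have hfpos : 0 < f 0 := by
    have : f 0 = Real.sin θ := by
      simp only [f, k]
      rw [if_pos (by lia)]
      simp
    rw [this]
    refine Real.sin_pos_of_pos_of_lt_pi (by positivity) ?_
    rw [hθ, div_lt_iff₀ hL0]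
    have : (2 : ℝ) ≤ L := by exact_mod_cast hL
    nlinarith [Real.pi_pos]
  refine ⟨C⁻¹ * f 0, by positivity, fun n => ?_⟩
  have hle : C⁻¹ • f ≤ fun x : ℤ => if x ≤ 0 then (1 : ℝ) else 0 := by
    intro x
    simp only [Pi.smul_apply, smul_eq_mul]
    split_ifs with hx
    · rw [inv_mul_le_iff₀ hC0, mul_one]
      exact hC x
    · have : f x = 0 := by
        by_cases h1 : x = 1
        · simp [f, h1, hk_one]
        · exact if_neg (by lia)
      simp [this]
  have h1 := (walkStep_mono hu.le hv.le huv).iterate n hle 0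
  rw [iterate_walkStep_smul] at h1
  have h2 := pow_le_iterate_walkStep hu.le hv.le huv hstep h0 n 0
  simp only [Pi.smul_apply, smul_eq_mul] at h1 h2
  calc C⁻¹ * f 0 * ρ ^ n = C⁻¹ * (ρ ^ n * f 0) := by ring
    _ ≤ C⁻¹ * (walkStep u v)^[n] f 0 := by gcongr
    _ ≤ _ := h1

/-- The exponential rate in the Chernoff bound is optimal. -/
theorem exists_pow_le_walkFailure (hu : 0 < u) (hv : 0 ≤ v) (huv : u + v ≤ 1) {r : ℝ}
    (hr0 : 0 ≤ r) (hr : r < 2 * √(u * v) + (1 - u - v)) :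
    ∃ c > 0, ∀ n, c * r ^ n ≤ walkFailure u v n := by
  have h1 : 0 ≤ 1 - u - v := by linarith
  rcases hv.eq_or_lt with rfl | hv
  -- Without down-steps, failure means never moving, which already gives the rate `1 - u`.
  · refine ⟨1, one_pos, fun n => ?_⟩
    have hT : (1 - u) • (fun x : ℤ => if x ≤ 0 then (1 : ℝ) else 0)
        ≤ walkStep u 0 (fun x : ℤ => if x ≤ 0 then (1 : ℝ) else 0) := by
      intro x
      simp only [walkStep, Pi.smul_apply, smul_eq_mul]
      have : 0 ≤ u * if x + 1 ≤ 0 then (1 : ℝ) else 0 := by positivity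
      linarith
    have h := pow_le_iterate_walkStep hu.le le_rfl huv hT (by linarith) n 0
    simp only [Pi.smul_apply, le_refl, if_true, smul_eq_mul, mul_one] at h
    rw [one_mul]
    refine le_trans ?_ h
    have : r ≤ 1 - u := by simpa using hr.le
    gcongr
  -- The eigenvalue on an interval of length `L` tends to the Chernoff rate as `cos (π / L) → 1`.
  · have hlim : Filter.Tendsto
        (fun L : ℕ => 2 * √(u * v) * Real.cos (Real.pi / L) + (1 - u - v)) Filter.atTop
        (nhds (2 * √(u * v) * Real.cos 0 + (1 - u - v))) :=
      (((Real.continuous_cos.tendsto 0).comp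
        (tendsto_const_div_atTop_nhds_zero_nat Real.pi)).const_mul _).add_const _
    rw [Real.cos_zero, mul_one] at hlim
    obtain ⟨L, hL, hL2⟩ :=
      ((hlim.eventually_const_lt hr).and (Filter.eventually_ge_atTop 2)).exists
    obtain ⟨c, hc, h⟩ := pow_le_walkFailure_of_cos hu hv huv hL2 (hr0.trans hL.le)
    refine ⟨c, hc, fun n => le_trans ?_ (h n)⟩
    gcongr

end WalkStep

/-! ### The majority of independent voters -/

/-- The expectation of `g K`, where `K` is binomially distributed with parameters `m` and `q`. -/
noncomputable def binomialMean (q : ℝ) (m : ℕ) (g : ℕ → ℝ) : ℝ :=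
  ∑ k ∈ Finset.range (m + 1), (m.choose k : ℝ) * q ^ k * (1 - q) ^ (m - k) * g k

/-- Condition on the vote of one voter; on coefficients this is Pascal's rule. -/
theorem binomialMean_succ (q : ℝ) (m : ℕ) (g : ℕ → ℝ) :
    binomialMean q (m + 1) g
      = q * binomialMean q m (fun k => g (k + 1)) + (1 - q) * binomialMean q m g := by
  have h2 : (1 - q) * binomialMean q m g = (1 - q) ^ (m + 1) * g 0
      + ∑ k ∈ Finset.range (m + 1),
        (m.choose (k + 1) : ℝ) * q ^ (k + 1) * (1 - q) ^ (m - k) * g (k + 1) := by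
    rw [Finset.sum_range_succ, Nat.choose_succ_self, binomialMean, Finset.sum_range_succ',
      mul_add, Finset.mul_sum]
    have : ∀ k ∈ Finset.range m,
        (1 - q) * ((m.choose (k + 1) : ℝ) * q ^ (k + 1) * (1 - q) ^ (m - (k + 1)) * g (k + 1))
          = (m.choose (k + 1) : ℝ) * q ^ (k + 1) * (1 - q) ^ (m - k) * g (k + 1) := by
      intro k hk
      rw [Finset.mem_range] at hk
      rw [show m - k = (m - (k + 1)) + 1 by lia, pow_succ]
      ring
    rw [Finset.sum_congr rfl this]
    simp only [Nat.choose_zero_right, Nat.cast_one, pow_zero, Nat.sub_zero, Nat.cast_zero]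
    ring
  rw [h2, binomialMean, Finset.sum_range_succ', binomialMean, Finset.mul_sum, add_left_comm,
    ← Finset.sum_add_distrib, add_comm]
  congr 1
  · simp
  · refine Finset.sum_congr rfl fun k _ => ?_
    rw [Nat.choose_succ_succ, Nat.add_sub_add_right]
    push_cast
    ring

theorem binomialMean_add (q : ℝ) (m : ℕ) (g h : ℕ → ℝ) :
    binomialMean q m (fun k => g k + h k) = binomialMean q m g + binomialMean q m h := by
  simp only [binomialMean, mul_add, Finset.sum_add_distrib]

theorem binomialMean_sub (q : ℝ) (m : ℕ) (g h : ℕ → ℝ) :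
    binomialMean q m (fun k => g k - h k) = binomialMean q m g - binomialMean q m h := by
  simp only [binomialMean, mul_sub, Finset.sum_sub_distrib]

theorem binomialMean_one (q : ℝ) (m : ℕ) : binomialMean q m (fun _ => 1) = 1 := by
  induction m with
  | zero => simp [binomialMean]
  | succ m ih => rw [binomialMean_succ, ih]; ring

theorem binomialMean_single (q : ℝ) {m j : ℕ} (hj : j ≤ m) :
    binomialMean q m (fun k => if k = j then 1 else 0)
      = (m.choose j : ℝ) * q ^ j * (1 - q) ^ (m - j) := by
  simp [binomialMean, hj]

theorem majorityAccuracy_eq_binomialMean (m : ℕ) (q : ℝ) :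
    majorityAccuracy m q = binomialMean q m (fun k => if m < 2 * k then 1 else 0) := by
  simp [majorityAccuracy, binomialMean, Finset.sum_filter]

theorem majorityAccuracy_one (q : ℝ) : majorityAccuracy 1 q = q := by
  simp [majorityAccuracy_eq_binomialMean, binomialMean, Finset.sum_range_succ]

theorem continuous_majorityAccuracy (m : ℕ) : Continuous (majorityAccuracy m) := by
  unfold majorityAccuracy
  fun_prop

theorem majorityAccuracy_nonneg (m : ℕ) {q : ℝ} (h0 : 0 ≤ q) (h1 : q ≤ 1) :
    0 ≤ majorityAccuracy m q := by
  have : 0 ≤ 1 - q := by linarith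
  unfold majorityAccuracy
  positivity

/-- Exchanging the two options turns a majority of an odd number of voters into a minority. -/
theorem majorityAccuracy_one_sub {m : ℕ} (hm : Odd m) (q : ℝ) :
    majorityAccuracy m (1 - q) = 1 - majorityAccuracy m q := by
  rw [eq_sub_iff_add_eq, majorityAccuracy_eq_binomialMean, majorityAccuracy_eq_binomialMean]
  have : binomialMean (1 - q) m (fun k => if m < 2 * k then 1 else 0)
      = binomialMean q m (fun k => if m < 2 * k then 0 else 1) := by
    unfold binomialMean
    rw [← Finset.sum_range_reflect]
    refine Finset.sum_congr rfl fun k hk => ?_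
    have hk' : k ≤ m := Nat.lt_succ_iff.1 (Finset.mem_range.1 hk)
    rw [show m + 1 - 1 - k = m - k by lia, Nat.choose_symm hk', Nat.sub_sub_self hk']
    -- Oddness excludes the tie `2 * k = m`.
    obtain ⟨r, rfl⟩ := hm
    dsimp only
    split_ifs <;> first | lia | ring
  rw [this, ← binomialMean_add]
  refine Eq.trans ?_ (binomialMean_one q m)
  congr 1
  ext k
  split_ifs <;> norm_num

theorem majorityAccuracy_le_one {m : ℕ} (hm : Odd m) {q : ℝ} (h0 : 0 ≤ q) (h1 : q ≤ 1) :
    majorityAccuracy m q ≤ 1 := by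
  have := majorityAccuracy_nonneg m (q := 1 - q) (by linarith) (by linarith)
  rw [majorityAccuracy_one_sub hm] at this
  linarith

/-- The gain from two additional voters. -/
theorem majorityAccuracy_add_two (r : ℕ) (q : ℝ) :
    majorityAccuracy (2 * r + 3) q = majorityAccuracy (2 * r + 1) q
      + (q - 1 / 2) * ((r + 1).centralBinom * (q * (1 - q)) ^ (r + 1)) := by
  rw [majorityAccuracy_eq_binomialMean, majorityAccuracy_eq_binomialMean,
    show 2 * r + 3 = 2 * r + 1 + 1 + 1 by ring,
    binomialMean_succ q (2 * r + 1 + 1), binomialMean_succ q (2 * r + 1),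
    binomialMean_succ q (2 * r + 1)]
  -- Two new voters matter only if they agree and the old majority is by one vote: two wrong votes
  -- overturn `k = r + 1` (`e0`), two right votes rescue `k = r` (`e2`), and a split changes nothing
  -- (`e1`).
  set F := binomialMean q (2 * r + 1) (fun k => if 2 * r + 1 < 2 * k then 1 else 0) with hF
  have e0 : binomialMean q (2 * r + 1) (fun k => if 2 * r + 1 + 1 + 1 < 2 * k then 1 else 0)
      = F - (2 * r + 1).choose (r + 1) * q ^ (r + 1) * (1 - q) ^ r := by
    have h := binomialMean_single q (show r + 1 ≤ 2 * r + 1 by lia)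
    rw [show 2 * r + 1 - (r + 1) = r by lia] at h
    rw [hF, ← h, ← binomialMean_sub]
    congr 1
    ext k
    split_ifs <;> first | lia | norm_num
  have e1 : binomialMean q (2 * r + 1) (fun k => if 2 * r + 1 + 1 + 1 < 2 * (k + 1) then 1 else 0)
      = F := by
    rw [hF]
    congr 1
    ext k
    split_ifs <;> lia
  have e2 : binomialMean q (2 * r + 1)
      (fun k => if 2 * r + 1 + 1 + 1 < 2 * (k + 1 + 1) then 1 else 0)
      = F + (2 * r + 1).choose r * q ^ r * (1 - q) ^ (r + 1) := by
    have h := binomialMean_single q (show r ≤ 2 * r + 1 by lia)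
    rw [show 2 * r + 1 - r = r + 1 by lia] at h
    rw [hF, ← h, ← binomialMean_add]
    congr 1
    ext k
    split_ifs <;> first | lia | norm_num
  have hsymm : (2 * r + 1).choose (r + 1) = (2 * r + 1).choose r :=
    Nat.choose_symm_of_eq_add (by ring)
  have hc : ((r + 1).centralBinom : ℝ) = 2 * (2 * r + 1).choose r := by
    rw [Nat.centralBinom, show 2 * (r + 1) = 2 * r + 1 + 1 by ring, Nat.choose_succ_succ, hsymm]
    push_cast
    ring
  rw [e0, e1, e2, hc, hsymm, mul_pow]
  ring

/-- The majority accuracy of an odd number of voters as an expansion around `1 / 2`. -/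
theorem majorityAccuracy_eq_sum (r : ℕ) (q : ℝ) :
    majorityAccuracy (2 * r + 1) q
      = 1 / 2 + (q - 1 / 2) * ∑ j ∈ Finset.range (r + 1), j.centralBinom * (q * (1 - q)) ^ j := by
  induction r with
  | zero => simp [majorityAccuracy_one]
  | succ r ih =>
    rw [show 2 * (r + 1) + 1 = 2 * r + 3 by ring, majorityAccuracy_add_two, ih,
      Finset.sum_range_succ _ (r + 1)]
    ring

/-- Majority votes amplify a mixture of correct and reversed voters less than they amplify
voters of the average accuracy. -/
theorem majorityAccuracy_mixture_le {m : ℕ} (hm : Odd m) {a b qb qw : ℝ} (hb : 0 ≤ b)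
    (hba : b < a) (hqw : 1 / 2 < qw) (hq : qw ≤ qb) (hqb : qb ≤ 1) :
    majorityAccuracy m qb * a + (1 - majorityAccuracy m qw) * b
      ≤ (a + b) * majorityAccuracy m ((qb * a + (1 - qw) * b) / (a + b)) := by
  obtain ⟨r, rfl⟩ := hm
  have hab : 0 < a + b := by linarith
  set q := (qb * a + (1 - qw) * b) / (a + b) with hqdef
  have hqab : q * (a + b) = qb * a + (1 - qw) * b := by rw [hqdef]; field_simp
  have hq1 : 1 / 2 ≤ q := by
    rw [hqdef, le_div_iff₀ hab]
    nlinarith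
  have hq2 : q ≤ qb := by
    rw [hqdef, div_le_iff₀ hab]
    nlinarith
  -- `R` is the amplification of `q - 1 / 2`. It decreases on `[1 / 2, 1]` because `q * (1 - q)`
  -- does, so `R qb` is the smallest of the three amplifications in play.
  let R : ℝ → ℝ := fun q => ∑ j ∈ Finset.range (r + 1), (j.centralBinom : ℝ) * (q * (1 - q)) ^ j
  have hR : ∀ x y : ℝ, 1 / 2 ≤ x → x ≤ y → y ≤ 1 → R y ≤ R x := by
    intro x y hx hxy hy
    have h0 : 0 ≤ y * (1 - y) := mul_nonneg (by linarith) (by linarith)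
    have h1 : y * (1 - y) ≤ x * (1 - x) := by nlinarith
    refine Finset.sum_le_sum fun j _ => ?_
    gcongr
  simp only [majorityAccuracy_eq_sum]
  change (1 / 2 + (qb - 1 / 2) * R qb) * a + (1 - (1 / 2 + (qw - 1 / 2) * R qw)) * b
    ≤ (a + b) * (1 / 2 + (q - 1 / 2) * R q)
  have h1 : 0 ≤ (qw - 1 / 2) * b * (R qw - R qb) :=
    mul_nonneg (mul_nonneg (by linarith) hb) (sub_nonneg.2 (hR qw qb hqw.le hq hqb))
  have h2 : 0 ≤ (a + b) * (q - 1 / 2) * (R q - R qb) :=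
    mul_nonneg (mul_nonneg hab.le (by linarith)) (sub_nonneg.2 (hR q qb hq1 hq2 hqb))
  have h3 : (a + b) * (q - 1 / 2) * R qb
      = ((qb - 1 / 2) * a - (qw - 1 / 2) * b) * R qb := by
    congr 1
    linarith
  linarith

/-- Cauchy–Schwarz over the majority counts `k`, applied to the binomial weights for `q` and `1 -
q`: the geometric mean of the two weights is `m.choose k * √(q * (1 - q)) ^ m`. -/
theorem sqrt_pow_le_sqrt_majorityAccuracy {m : ℕ} (hm : Odd m) {q : ℝ} (h0 : 0 ≤ q)
    (h1 : q ≤ 1) :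
    (2 * √(q * (1 - q))) ^ m ≤ 2 * √(majorityAccuracy m q * (1 - majorityAccuracy m q)) := by
  have h1' : 0 ≤ 1 - q := by linarith
  set s := (Finset.range (m + 1)).filter (fun k => m < 2 * k) with hs
  -- Read off from the exchange symmetry at `q = 1 / 2`, where a majority has probability one half.
  have hchoose : ∑ k ∈ s, (m.choose k : ℝ) = 2 ^ m / 2 := by
    have h := majorityAccuracy_one_sub hm (1 / 2)
    have h2 : majorityAccuracy m (1 / 2) = (∑ k ∈ s, (m.choose k : ℝ)) * (1 / 2) ^ m := by
      rw [majorityAccuracy, Finset.sum_mul]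
      refine Finset.sum_congr rfl fun k hk => ?_
      have hk' : k ≤ m := by
        rw [hs, Finset.mem_filter, Finset.mem_range] at hk
        lia
      rw [show (1 : ℝ) - 1 / 2 = 1 / 2 by norm_num, mul_assoc, ← pow_add, Nat.add_sub_cancel' hk']
    norm_num only at h h2
    rw [h2, div_pow, one_pow] at h
    field_simp at h ⊢
    linarith
  have hcs := Real.sum_sqrt_mul_sqrt_le s
    (f := fun k => (m.choose k : ℝ) * q ^ k * (1 - q) ^ (m - k))
    (g := fun k => (m.choose k : ℝ) * (1 - q) ^ k * (1 - (1 - q)) ^ (m - k))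
    (fun k => by positivity) (fun k => by rw [sub_sub_cancel]; positivity)
  change _ ≤ √(majorityAccuracy m q) * √(majorityAccuracy m (1 - q)) at hcs
  have hterm : ∀ k ∈ s, √((m.choose k : ℝ) * q ^ k * (1 - q) ^ (m - k))
      * √((m.choose k : ℝ) * (1 - q) ^ k * (1 - (1 - q)) ^ (m - k))
      = (m.choose k : ℝ) * √(q * (1 - q)) ^ m := by
    intro k hk
    have hk' : k ≤ m := by
      rw [hs, Finset.mem_filter, Finset.mem_range] at hk
      lia
    rw [← Real.sqrt_mul (by positivity), sub_sub_cancel]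
    refine (Real.sqrt_eq_iff_mul_self_eq (by positivity) (by positivity)).2 ?_
    have e : √(q * (1 - q)) ^ m * √(q * (1 - q)) ^ m = q ^ m * (1 - q) ^ m := by
      rw [← mul_pow, Real.mul_self_sqrt (by positivity), mul_pow]
    calc _ = (m.choose k : ℝ) ^ 2 * ((q ^ k * q ^ (m - k)) * ((1 - q) ^ k * (1 - q) ^ (m - k))) := by
          ring
      _ = (m.choose k : ℝ) ^ 2 * (√(q * (1 - q)) ^ m * √(q * (1 - q)) ^ m) := by
          rw [e, ← pow_add, ← pow_add, Nat.add_sub_cancel' hk']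
      _ = _ := by ring
  rw [Finset.sum_congr rfl hterm, ← Finset.sum_mul, hchoose, majorityAccuracy_one_sub hm,
    ← Real.sqrt_mul (majorityAccuracy_nonneg m h0 h1)] at hcs
  rw [mul_pow]
  linarith

/-! ### Sums of independent gap indicators -/

section WalkLaw

variable {Ω : Type*} [MeasurableSpace Ω] {ν : Measure Ω} [IsProbabilityMeasure ν] {g : Ω → ℤ}

theorem integral_comp_add_eq_walkStep (hg : Measurable g)
    (hval : ∀ᵐ ω ∂ν, g ω = 1 ∨ g ω = -1 ∨ g ω = 0) (f : ℤ → ℝ) (x : ℤ) :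
    ∫ ω, f (x + g ω) ∂ν = walkStep (ν.real {ω | g ω = 1}) (ν.real {ω | g ω = -1}) f x := by
  have hm1 : MeasurableSet {ω | g ω = 1} := hg (measurableSet_singleton 1)
  have hm2 : MeasurableSet {ω | g ω = -1} := hg (measurableSet_singleton (-1))
  have hae : (fun ω => f (x + g ω)) =ᵐ[ν] fun ω => f x
      + ({ω | g ω = 1}.indicator (fun _ => f (x + 1) - f x) ω
        + {ω | g ω = -1}.indicator (fun _ => f (x - 1) - f x) ω) := by
    filter_upwards [hval] with ω hω
    rcases hω with h | h | h <;> simp [Set.indicator, h, sub_eq_add_neg]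
  have i1 : Integrable ({ω | g ω = 1}.indicator (fun _ => f (x + 1) - f x)) ν :=
    (integrable_const _).indicator hm1
  have i2 : Integrable ({ω | g ω = -1}.indicator (fun _ => f (x - 1) - f x)) ν :=
    (integrable_const _).indicator hm2
  have i12 : Integrable (fun ω => {ω | g ω = 1}.indicator (fun _ => f (x + 1) - f x) ω
      + {ω | g ω = -1}.indicator (fun _ => f (x - 1) - f x) ω) ν := i1.add i2
  rw [integral_congr_ae hae, integral_add (integrable_const _) i12, integral_add i1 i2,
    integral_indicator_const _ hm1, integral_indicator_const _ hm2, integral_const, walkStep]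
  simp only [probReal_univ, smul_eq_mul]
  ring

/-- Markov property: split off the first step by Fubini, for which `f` is taken bounded. -/
theorem integral_pi_eq_iterate_walkStep {u v : ℝ} (hg : Measurable g)
    (hstep : ∀ (f : ℤ → ℝ) (x : ℤ), ∫ ω, f (x + g ω) ∂ν = walkStep u v f x)
    (n : ℕ) {f : ℤ → ℝ} {C : ℝ} (hf : ∀ x, |f x| ≤ C) (x : ℤ) :
    ∫ ω, f (x + ∑ i, g (ω i)) ∂(Measure.pi fun _ : Fin n => ν) = (walkStep u v)^[n] f x := by
  induction n generalizing x with
  | zero => simp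
  | succ n ih =>
    have hmeas : Measurable fun z : Ω × (Fin n → Ω) => f (x + g z.1 + ∑ i, g (z.2 i)) :=
      (measurable_of_countable f).comp (by fun_prop)
    have hmp := (measurePreserving_piFinSuccAbove (fun _ : Fin (n + 1) => ν) 0).symm
    rw [← hmp.integral_comp', Function.iterate_succ_apply', ← hstep]
    simp only [← ih]
    rw [← integral_prod (f := fun z : Ω × (Fin n → Ω) => f (x + g z.1 + ∑ i, g (z.2 i)))]
    · refine integral_congr_ae (Filter.Eventually.of_forall fun z => ?_)
      simp [MeasurableEquiv.piFinSuccAbove, Fin.sum_univ_succ, add_assoc]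
    · exact Integrable.of_bound hmeas.aestronglyMeasurable C
        (Filter.Eventually.of_forall fun z => hf _)

theorem real_pi_sum_pos_eq (hg : Measurable g)
    (hval : ∀ᵐ ω ∂ν, g ω = 1 ∨ g ω = -1 ∨ g ω = 0) (n : ℕ) :
    (Measure.pi fun _ : Fin n => ν).real {ω | 0 < ∑ i, g (ω i)}
      = 1 - walkFailure (ν.real {ω | g ω = 1}) (ν.real {ω | g ω = -1}) n := by
  have hmeas : MeasurableSet {ω : Fin n → Ω | 0 < ∑ i, g (ω i)} :=
    measurableSet_lt measurable_const (by fun_prop)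
  have h := integral_pi_eq_iterate_walkStep hg (integral_comp_add_eq_walkStep hg hval) n
    (f := fun x => 1 - if x ≤ 0 then 1 else 0) (C := 1)
    (fun x => by split_ifs <;> norm_num) 0
  rw [iterate_walkStep_one_sub] at h
  rw [walkFailure, ← h, ← integral_indicator_one hmeas]
  refine integral_congr_ae (Filter.Eventually.of_forall fun ω => ?_)
  simp only [Set.indicator, Set.mem_ofPred_eq, zero_add, Pi.one_apply]
  split_ifs <;> first | lia | norm_num

end WalkLaw

theorem iterate_walkStep_zero_eq_binomialMean (q : ℝ) (m : ℕ) (f : ℤ → ℝ) (x : ℤ) :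
    (walkStep q 0)^[m] f x = binomialMean q m (fun k => f (x + k)) := by
  induction m generalizing x with
  | zero => simp [binomialMean]
  | succ m ih =>
    rw [Function.iterate_succ_apply', walkStep, ih, ih, ih, binomialMean_succ]
    simp only [Nat.cast_add, Nat.cast_one, add_assoc, add_comm (1 : ℤ)]
    ring

/-- The number of votes for `true` is a walk without down-steps, so the walk computation also gives
the binomial law. -/
theorem real_pi_majorityVote {Ω : Type*} [MeasurableSpace Ω] (ν : Measure Ω)
    [IsProbabilityMeasure ν] {w : Ω → Bool} (hw : Measurable w) (m : ℕ) :
    (Measure.pi fun _ : Fin m => ν).real {l | majorityVote (fun j => w (l j)) = true}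
      = majorityAccuracy m (ν.real {ω | w ω = true}) := by
  let g : Ω → ℤ := fun ω => if w ω = true then 1 else 0
  have hg : Measurable g :=
    (measurable_of_countable fun b : Bool => if b = true then (1 : ℤ) else 0).comp hw
  have e1 : {ω | g ω = 1} = {ω | w ω = true} := by ext; simp [g]
  have e2 : {ω | g ω = -1} = ∅ := by
    ext ω
    simp only [g, Set.mem_ofPred_eq, Set.mem_empty_iff_false, iff_false]
    split_ifs <;> norm_num
  have hstep := integral_comp_add_eq_walkStep (ν := ν) hg
    (Filter.Eventually.of_forall fun ω => by simp only [g]; split_ifs <;> simp)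
  rw [e1, e2, measureReal_empty] at hstep
  have h := integral_pi_eq_iterate_walkStep hg hstep m
    (f := fun x => if (m : ℤ) < 2 * x then 1 else 0) (C := 1)
    (fun x => by split_ifs <;> norm_num) 0
  rw [iterate_walkStep_zero_eq_binomialMean] at h
  have hsum : ∀ l : Fin m → Ω,
      ∑ i, g (l i) = ((Finset.univ.filter fun j => w (l j) = true).card : ℤ) := by
    intro l
    simp [g]
  have hset : {l : Fin m → Ω | majorityVote (fun j => w (l j)) = true}
      = {l | (m : ℤ) < 2 * ∑ i, g (l i)} := by
    ext l
    rw [Set.mem_ofPred_eq, Set.mem_ofPred_eq, hsum, majorityVote, decide_eq_true_iff]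
    norm_cast
  have hmeas : MeasurableSet {l : Fin m → Ω | (m : ℤ) < 2 * ∑ i, g (l i)} :=
    measurableSet_lt measurable_const (by fun_prop)
  rw [hset, ← integral_indicator_one hmeas, majorityAccuracy_eq_binomialMean]
  simp only [zero_add] at h
  simp only [Set.indicator, Set.mem_ofPred_eq, Pi.one_apply]
  exact_mod_cast h

theorem real_cond_apply {Ω : Type*} [MeasurableSpace Ω] (μ : Measure Ω) {s : Set Ω}
    (hs : MeasurableSet s) (t : Set Ω) : (μ[|s]).real t = (μ.real s)⁻¹ * μ.real (s ∩ t) := by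
  simp only [measureReal_def, cond_apply hs, ENNReal.toReal_mul, ENNReal.toReal_inv]

/-! ### Labeling problems as lazy walks -/

namespace LabelingModel

variable {X L : Type*} [MeasurableSpace X] [MeasurableSpace L] (P : LabelingModel X L)

attribute [instance] isProb_dist isProb_crowd

theorem measurable_labelAccuracy : Measurable P.labelAccuracy := by
  have hs : MeasurableSet {z : L × X | P.label z.1 z.2 = P.yTrue z.2} :=
    measurableSet_eq_fun P.measurable_label (P.measurable_yTrue.comp measurable_snd)
  exact (measurable_measure_prodMk_right hs).ennreal_toReal

theorem labelAccuracy_nonneg (x : X) : 0 ≤ P.labelAccuracy x := measureReal_nonneg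

theorem labelAccuracy_le_one (x : X) : P.labelAccuracy x ≤ 1 := measureReal_le_one

theorem measurable_label_right (x : X) : Measurable fun l => P.label l x :=
  P.measurable_label.comp (measurable_id.prodMk measurable_const)

theorem measurable_vote (m : ℕ) :
    Measurable fun z : X × (Fin m → L) => majorityVote (fun j => P.label (z.2 j) z.1) := by
  refine (measurable_of_countable (majorityVote (m := m))).comp (measurable_pi_lambda _ fun j => ?_)
  have h : Measurable fun z : X × (Fin m → L) => (z.2 j, z.1) :=
    ((measurable_pi_apply j).comp measurable_snd).prodMk measurable_fst
  exact P.measurable_label.comp h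

theorem real_vote_eq_true (m : ℕ) (x : X) :
    (Measure.pi fun _ : Fin m => P.crowd).real
        {l | majorityVote (fun j => P.label (l j) x) = true}
      = majorityAccuracy m (P.crowd.real {l | P.label l x = true}) :=
  real_pi_majorityVote P.crowd (P.measurable_label_right x) m

/-- The majority label is correct with the probability of a correct majority of voters. -/
theorem real_vote_eq_yTrue {m : ℕ} (hm : Odd m) (x : X) :
    (Measure.pi fun _ : Fin m => P.crowd).real
        {l | majorityVote (fun j => P.label (l j) x) = P.yTrue x}
      = majorityAccuracy m (P.labelAccuracy x) := by
  have hmeas : MeasurableSet {l : Fin m → L | majorityVote (fun j => P.label (l j) x) = true} :=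
    ((P.measurable_vote m).comp (measurable_const.prodMk measurable_id))
      (measurableSet_singleton true)
  have hmeas' : MeasurableSet {l : L | P.label l x = true} :=
    P.measurable_label_right x (measurableSet_singleton true)
  rcases hy : P.yTrue x
  · have e1 : {l : Fin m → L | majorityVote (fun j => P.label (l j) x) = false}
        = {l : Fin m → L | majorityVote (fun j => P.label (l j) x) = true}ᶜ := by ext; simp
    have e2 : {l : L | P.label l x = false} = {l : L | P.label l x = true}ᶜ := by ext; simp
    rw [labelAccuracy, hy, e1, e2, probReal_compl_eq_one_sub hmeas,
      probReal_compl_eq_one_sub hmeas', real_vote_eq_true, majorityAccuracy_one_sub hm]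
  · rw [labelAccuracy, hy, real_vote_eq_true]

theorem integrable_majorityAccuracy {m : ℕ} (hm : Odd m) (μ : Measure X) [IsFiniteMeasure μ] :
    Integrable (fun x => majorityAccuracy m (P.labelAccuracy x)) μ := by
  refine Integrable.of_bound ((continuous_majorityAccuracy m).measurable.comp
    P.measurable_labelAccuracy).aestronglyMeasurable 1 (Filter.Eventually.of_forall fun x => ?_)
  rw [Real.norm_of_nonneg (majorityAccuracy_nonneg m (P.labelAccuracy_nonneg x)
    (P.labelAccuracy_le_one x))]
  exact majorityAccuracy_le_one hm (P.labelAccuracy_nonneg x) (P.labelAccuracy_le_one x)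

theorem measurableSet_correct {c : X → Bool} (hc : Measurable c) :
    MeasurableSet {x | c x = P.yTrue x} :=
  measurableSet_eq_fun hc P.measurable_yTrue

/-- The probability that `c` agrees with the test label while `c'` does not. -/
theorem real_agree_and_disagree {m : ℕ} (hm : Odd m) {c c' : X → Bool} (hc : Measurable c)
    (hc' : Measurable c') :
    (P.dist.prod (Measure.pi fun _ : Fin m => P.crowd)).real
        {z | c z.1 = majorityVote (fun j => P.label (z.2 j) z.1) ∧
          c' z.1 ≠ majorityVote (fun j => P.label (z.2 j) z.1)}
      = ∫ x in {x | c x = P.yTrue x ∧ c' x ≠ P.yTrue x},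
          majorityAccuracy m (P.labelAccuracy x) ∂P.dist
        + ∫ x in {x | c x ≠ P.yTrue x ∧ c' x = P.yTrue x},
          (1 - majorityAccuracy m (P.labelAccuracy x)) ∂P.dist := by
  set S := {z : X × (Fin m → L) | c z.1 = majorityVote (fun j => P.label (z.2 j) z.1) ∧
          c' z.1 ≠ majorityVote (fun j => P.label (z.2 j) z.1)} with hS
  have hSm : MeasurableSet S :=
    (measurableSet_eq_fun (hc.comp measurable_fst) (P.measurable_vote m)).inter
      (measurableSet_eq_fun (hc'.comp measurable_fst) (P.measurable_vote m)).compl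
  have hA : MeasurableSet {x | c x = P.yTrue x ∧ c' x ≠ P.yTrue x} :=
    (P.measurableSet_correct hc).inter (P.measurableSet_correct hc').compl
  have hB : MeasurableSet {x | c x ≠ P.yTrue x ∧ c' x = P.yTrue x} :=
    (P.measurableSet_correct hc).compl.inter (P.measurableSet_correct hc')
  have hint := P.integrable_majorityAccuracy hm P.dist
  have hint' : Integrable (fun x => 1 - majorityAccuracy m (P.labelAccuracy x)) P.dist :=
    (integrable_const 1).sub hint
  rw [← integral_indicator_one hSm, integral_prod _ ((integrable_const 1).indicator hSm),
    ← integral_indicator hA, ← integral_indicator hB,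
    ← integral_add (hint.indicator hA) (hint'.indicator hB)]
  refine integral_congr_ae (Filter.Eventually.of_forall fun x => ?_)
  have hT : MeasurableSet
      {l : Fin m → L | majorityVote (fun j => P.label (l j) x) = P.yTrue x} :=
    measurableSet_eq_fun ((P.measurable_vote m).comp (measurable_const.prodMk measurable_id))
      measurable_const
  have hsec : MeasurableSet (Prod.mk x ⁻¹' S) := measurable_prodMk_left hSm
  have hin : ∫ l, S.indicator 1 (x, l) ∂(Measure.pi fun _ : Fin m => P.crowd)
      = (Measure.pi fun _ : Fin m => P.crowd).real (Prod.mk x ⁻¹' S) := by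
    rw [← integral_indicator_one hsec]
    rfl
  have hvote := P.real_vote_eq_yTrue hm x
  dsimp only
  rw [hin]
  -- Labels are binary, so the event is empty unless exactly one classifier is right; it then says
  -- that the vote is correct or that it is wrong, according to which one.
  by_cases h1 : c x = P.yTrue x <;> by_cases h2 : c' x = P.yTrue x
  · have : Prod.mk x ⁻¹' S = ∅ := by
      ext l
      simp only [hS, Set.mem_preimage, Set.mem_ofPred_eq, h1, h2, Set.mem_empty_iff_false]
      tauto
    simp [this, h1, h2]
  · have : Prod.mk x ⁻¹' S
        = {l : Fin m → L | majorityVote (fun j => P.label (l j) x) = P.yTrue x} := by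
      ext l
      simp only [hS, Set.mem_preimage, Set.mem_ofPred_eq, h1]
      constructor
      · exact fun h => h.1.symm
      · exact fun h => ⟨h.symm, fun h' => h2 (h'.trans h)⟩
    simp [this, h1, h2, hvote]
  · have : Prod.mk x ⁻¹' S
        = {l : Fin m → L | majorityVote (fun j => P.label (l j) x) = P.yTrue x}ᶜ := by
      ext l
      simp only [hS, Set.mem_preimage, Set.mem_ofPred_eq, h2, Set.mem_compl_iff]
      revert h1
      generalize majorityVote (fun j => P.label (l j) x) = y
      cases y <;> cases c x <;> cases P.yTrue x <;> simp
    simp [this, h1, h2, hvote, probReal_compl_eq_one_sub hT]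
  · have : Prod.mk x ⁻¹' S = ∅ := by
      ext l
      simp only [hS, Set.mem_preimage, Set.mem_ofPred_eq, Set.mem_empty_iff_false]
      revert h1 h2
      generalize majorityVote (fun j => P.label (l j) x) = y
      cases y <;> cases c x <;> cases c' x <;> cases P.yTrue x <;> simp
    simp [this, h1, h2]

theorem measurable_gap (m : ℕ) :
    Measurable fun z : X × (Fin m → L) => P.gap z.1 z.2 := by
  have hb := measurableSet_eq_fun (P.measurable_cb.comp measurable_fst) (P.measurable_vote m)
  have hw := measurableSet_eq_fun (P.measurable_cw.comp measurable_fst) (P.measurable_vote m)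
  exact Measurable.ite (hb.inter hw.compl) measurable_const
    (Measurable.ite (hw.inter hb.compl) measurable_const measurable_const)

theorem successProb_eq (m n : ℕ) :
    P.successProb m n = 1 - walkFailure
      ((P.dist.prod (Measure.pi fun _ : Fin m => P.crowd)).real {z | P.gap z.1 z.2 = 1})
      ((P.dist.prod (Measure.pi fun _ : Fin m => P.crowd)).real {z | P.gap z.1 z.2 = -1}) n := by
  refine real_pi_sum_pos_eq (P.measurable_gap m) (Filter.Eventually.of_forall fun z => ?_) n
  dsimp only [gap]
  split_ifs <;> simp

/-- Both sides vanish on a null event, so a null `P.eventW` needs no separate treatment in the gap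
probabilities. -/
theorem setIntegral_eq_real_mul_cond (E : Set X) (f : X → ℝ) :
    ∫ x in E, f x ∂P.dist = P.dist.real E * ∫ x, f x ∂(P.dist[|E]) := by
  rcases eq_or_ne (P.dist E) 0 with h | h
  · rw [Measure.restrict_eq_zero.2 h, measureReal_def, h]
    simp
  · rw [ProbabilityTheory.cond, integral_smul_measure, smul_eq_mul, ENNReal.toReal_inv,
      ← measureReal_def, mul_inv_cancel_left₀]
    exact (measureReal_ne_zero_iff).2 h

theorem setIntegral_one_sub {m : ℕ} (hm : Odd m) (E : Set X) :
    ∫ x in E, (1 - majorityAccuracy m (P.labelAccuracy x)) ∂P.dist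
      = P.dist.real E - ∫ x in E, majorityAccuracy m (P.labelAccuracy x) ∂P.dist := by
  rw [integral_sub (integrable_const 1) (P.integrable_majorityAccuracy hm _)]
  simp

theorem real_gap_eq_one {m : ℕ} (hm : Odd m) :
    (P.dist.prod (Measure.pi fun _ : Fin m => P.crowd)).real {z | P.gap z.1 z.2 = 1}
      = P.dist.real P.eventB * ∫ x, majorityAccuracy m (P.labelAccuracy x) ∂(P.dist[|P.eventB])
        + P.dist.real P.eventW
          * (1 - ∫ x, majorityAccuracy m (P.labelAccuracy x) ∂(P.dist[|P.eventW])) := by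
  have h := P.real_agree_and_disagree hm P.measurable_cb P.measurable_cw
  change _ = ∫ x in P.eventB, _ ∂P.dist + ∫ x in P.eventW, _ ∂P.dist at h
  rw [P.setIntegral_one_sub hm, P.setIntegral_eq_real_mul_cond P.eventB,
    P.setIntegral_eq_real_mul_cond P.eventW] at h
  rw [mul_sub, mul_one, ← h]
  congr 1
  ext z
  simp only [gap, Set.mem_ofPred_eq]
  split_ifs <;> simp_all

theorem real_gap_eq_neg_one {m : ℕ} (hm : Odd m) :
    (P.dist.prod (Measure.pi fun _ : Fin m => P.crowd)).real {z | P.gap z.1 z.2 = -1}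
      = P.dist.real P.eventB
          * (1 - ∫ x, majorityAccuracy m (P.labelAccuracy x) ∂(P.dist[|P.eventB]))
        + P.dist.real P.eventW
          * ∫ x, majorityAccuracy m (P.labelAccuracy x) ∂(P.dist[|P.eventW]) := by
  have h := P.real_agree_and_disagree hm P.measurable_cw P.measurable_cb
  have e1 : {x | P.cw x = P.yTrue x ∧ P.cb x ≠ P.yTrue x} = P.eventW := by
    ext; exact and_comm
  have e2 : {x | P.cw x ≠ P.yTrue x ∧ P.cb x = P.yTrue x} = P.eventB := by
    ext; exact and_comm
  rw [e1, e2, P.setIntegral_one_sub hm, P.setIntegral_eq_real_mul_cond P.eventB,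
    P.setIntegral_eq_real_mul_cond P.eventW] at h
  rw [mul_sub, mul_one, add_comm, ← h]
  congr 1
  ext z
  simp only [gap, Set.mem_ofPred_eq]
  split_ifs <;> simp_all

variable {P} {qb qw pw pb0 pb1 : ℝ}

theorem HasParameters.real_eventB (h : P.HasParameters qb qw pw pb0 pb1) (hpw : pw ≠ 1) :
    P.dist.real P.eventB = (1 - pw) * pb0 := by
  have hm := P.measurableSet_correct P.measurable_cw
  have hm' : MeasurableSet {x | P.cw x ≠ P.yTrue x} := hm.compl
  have hc : P.dist.real {x | P.cw x ≠ P.yTrue x} = 1 - pw := by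
    rw [← h.pw_eq, ← probReal_compl_eq_one_sub hm]
    rfl
  rw [← h.pb0_eq, real_cond_apply _ hm', hc, mul_inv_cancel_left₀ (sub_ne_zero.2 hpw.symm)]
  congr 1
  ext
  exact and_comm

theorem HasParameters.real_eventW (h : P.HasParameters qb qw pw pb0 pb1) (hpw : pw ≠ 0) :
    P.dist.real P.eventW = pw * (1 - pb1) := by
  have hm := P.measurableSet_correct P.measurable_cw
  have hm' := P.measurableSet_correct P.measurable_cb
  have hc := measureReal_inter_add_sdiff (μ := P.dist) (s := {x | P.cw x = P.yTrue x}) hm'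
  have e : {x | P.cw x = P.yTrue x} \ {x | P.cb x = P.yTrue x} = P.eventW := by
    ext
    exact and_comm
  rw [← h.pb1_eq, real_cond_apply _ hm, h.pw_eq, mul_sub, mul_inv_cancel_left₀ hpw]
  rw [e, h.pw_eq] at hc
  linarith

end LabelingModel

/-! ### Comparison of the two ways to spend the labels -/

/-- If a walk with effective accuracy `q` runs `m` times as long as the walk whose accuracy is
boosted by a majority of `m` votes, it has the smaller probability of failure. -/
theorem exists_walkFailure_lt {m : ℕ} (hm : 1 < m) (hm_odd : Odd m) {s q : ℝ} (hs : 0 < s)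
    (hs1 : s < 1) (hq : 1 / 2 < q) (hq1 : q ≤ 1) :
    ∃ N : ℕ, ∀ n, N < n → walkFailure (s * q) (s * (1 - q)) (m * n)
      < walkFailure (s * majorityAccuracy m q) (s * (1 - majorityAccuracy m q)) n := by
  set M := majorityAccuracy m q with hM
  have hM1 : M ≤ 1 := majorityAccuracy_le_one hm_odd (by linarith) hq1
  have hMq : 1 / 2 < M := by
    obtain ⟨r, rfl⟩ := hm_odd
    rw [hM, majorityAccuracy_eq_sum, Finset.sum_range_succ']
    have h : 0 ≤ ∑ j ∈ Finset.range r, ((j + 1).centralBinom : ℝ) * (q * (1 - q)) ^ (j + 1) := by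
      have : 0 ≤ q * (1 - q) := mul_nonneg (by linarith) (by linarith)
      positivity
    simp only [pow_zero, Nat.centralBinom_zero, Nat.cast_one, mul_one]
    nlinarith
  have hsqrt : ∀ t : ℝ, √(s * t * (s * (1 - t))) = s * √(t * (1 - t)) := by
    intro t
    rw [show s * t * (s * (1 - t)) = s ^ 2 * (t * (1 - t)) by ring, Real.sqrt_mul (by positivity),
      Real.sqrt_sq hs.le]
  set y := 2 * √(q * (1 - q)) with hy
  have hy0 : 0 ≤ y := by positivity
  have hy1 : y < 1 := by
    have : √(q * (1 - q)) < 1 / 2 := by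
      rw [Real.sqrt_lt' (by norm_num)]
      nlinarith [sq_pos_of_pos (show 0 < q - 1 / 2 by linarith)]
    linarith
  have hyM : y ^ m ≤ 2 * √(M * (1 - M)) := sqrt_pow_le_sqrt_majorityAccuracy hm_odd (by linarith) hq1
  -- Strict Jensen for the points `y < 1` and `1` with weights `s` and `1 - s`; this is where `1 <
  -- m` and `s < 1` enter.
  have hconv : (s * y + (1 - s)) ^ m < s * y ^ m + (1 - s) := by
    have h := (strictConvexOn_pow (n := m) (by lia)).2 (Set.mem_Ici.2 hy0)
      (Set.mem_Ici.2 zero_le_one) hy1.ne hs (show 0 < 1 - s by linarith) (by ring)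
    simpa using h
  have hρ0 : 0 < s * y + (1 - s) := by nlinarith
  -- A rate strictly between the two absorbs the constant `c` of the lower bound for large `n`.
  obtain ⟨r, hr1, hr2⟩ := exists_between
    (hconv.trans_le (show _ ≤ s * (2 * √(M * (1 - M))) + (1 - s) by gcongr))
  have hr0 : 0 < r := (pow_pos hρ0 m).trans hr1
  obtain ⟨c, hc, hlower⟩ := exists_pow_le_walkFailure (u := s * M) (v := s * (1 - M)) (r := r)
    (by positivity) (mul_nonneg hs.le (by linarith)) (by linarith) hr0.le (by
      rw [hsqrt]
      linarith)
  have hupper := walkFailure_le (u := s * q) (v := s * (1 - q)) (by positivity)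
    (mul_nonneg hs.le (by linarith)) (by linarith) (by nlinarith)
  rw [hsqrt, show 2 * (s * √(q * (1 - q))) + (1 - s * q - s * (1 - q)) = s * y + (1 - s) by
    rw [hy]; ring] at hupper
  have hlim := tendsto_pow_atTop_nhds_zero_of_lt_one
    (div_nonneg (pow_pos hρ0 m).le hr0.le) ((div_lt_one hr0).2 hr1)
  obtain ⟨N, hN⟩ := Filter.eventually_atTop.1 (hlim.eventually_lt_const hc)
  refine ⟨N, fun n hn => (hupper (m * n)).trans_lt (lt_of_lt_of_le ?_ (hlower n))⟩
  have h := hN n hn.le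
  rw [div_pow, div_lt_iff₀ (pow_pos hr0 n)] at h
  rwa [pow_mul]

theorem sumPosProb_gapLaw {qb qw pw pb0 pb1 : ℝ}
    (hu : 0 ≤ qb * ((1 - pw) * pb0) + (1 - qw) * (pw * (1 - pb1)))
    (hv : 0 ≤ (1 - qb) * ((1 - pw) * pb0) + qw * (pw * (1 - pb1)))
    (h0 : 0 ≤ 1 - (1 - pw) * pb0 - pw * (1 - pb1)) (n : ℕ) :
    sumPosProb (gapLaw qb qw pw pb0 pb1) n = 1 - walkFailure
      (qb * ((1 - pw) * pb0) + (1 - qw) * (pw * (1 - pb1)))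
      ((1 - qb) * ((1 - pw) * pb0) + qw * (pw * (1 - pb1))) n := by
  set μ := gapLaw qb qw pw pb0 pb1 with hμ
  have hprob : IsProbabilityMeasure μ := by
    refine ⟨?_⟩
    simp only [hμ, gapLaw, Measure.add_apply, Measure.smul_apply, measure_univ, smul_eq_mul,
      mul_one]
    rw [← ENNReal.ofReal_add hu hv, ← ENNReal.ofReal_add (add_nonneg hu hv) h0,
      ENNReal.ofReal_eq_one]
    ring
  have e1 : μ.real {x | x = 1} = qb * ((1 - pw) * pb0) + (1 - qw) * (pw * (1 - pb1)) := by
    simp [hμ, gapLaw, measureReal_def, ENNReal.toReal_ofReal hu]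
  have e2 : μ.real {x | x = -1} = (1 - qb) * ((1 - pw) * pb0) + qw * (pw * (1 - pb1)) := by
    simp [hμ, gapLaw, measureReal_def, ENNReal.toReal_ofReal hv]
  rw [← e1, ← e2, sumPosProb]
  refine real_pi_sum_pos_eq (g := id) measurable_id ?_ n
  simp only [hμ, gapLaw, ae_add_measure_iff]
  refine ⟨⟨?_, ?_⟩, ?_⟩ <;> refine Measure.ae_smul_measure ?_ _ <;> rw [ae_dirac_eq] <;> simp

theorem mainTheorem1
    (m : ℕ) (hm : 1 < m) (hm_odd : Odd m)
    (qb qw pw pb0 pb1 : ℝ)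
    (hqb : qb ∈ Set.Ioc (1 / 2 : ℝ) 1) (hqw : qw ∈ Set.Ioc (1 / 2 : ℝ) 1)
    (hpw : pw ∈ Set.Icc (1 / 2 : ℝ) 1)
    (hpb0 : pb0 ∈ Set.Icc (1 / 2 : ℝ) 1) (hpb1 : pb1 ∈ Set.Icc (1 / 2 : ℝ) 1)
    (hbetter : pw < (1 - pw) * pb0 + pw * pb1)
    (hq : qw ≤ qb) :
    ∃ N : ℕ, ∀ n : ℕ, N < n →
      sumPosProb (gapLaw (majorityAccuracy m qb) (majorityAccuracy m qw) pw pb0 pb1) n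
          < sumPosProb (gapLaw qb qw pw pb0 pb1) (m * n) ∧
      ∀ {X L : Type*} [MeasurableSpace X] [MeasurableSpace L] (P : LabelingModel X L),
        P.HasParameters qb qw pw pb0 pb1 →
        P.NoBiasedHeterogeneity m qb qw pw pb0 pb1 →
        P.successProb m n < P.successProb 1 (m * n) := by
  obtain ⟨hqb0, hqb1⟩ := hqb
  obtain ⟨hqw0, hqw1⟩ := hqw
  obtain ⟨hpw0, hpw1⟩ := hpw
  obtain ⟨hpb00, hpb01⟩ := hpb0
  obtain ⟨hpb10, hpb11⟩ := hpb1
  have hpw_ne : pw ≠ 1 := by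
    rintro rfl
    linarith
  set a := (1 - pw) * pb0 with ha
  set b := pw * (1 - pb1) with hb
  have hb0 : 0 ≤ b := mul_nonneg (by linarith) (by linarith)
  have hba : b < a := by
    rw [hb]
    linarith
  have hab0 : 0 < a + b := by linarith
  -- The lower bound `1 / 2` on `pb1` leaves probability at least `pw / 2` that the classifiers
  -- agree.
  have hab1 : a + b < 1 := by
    have h1 : a ≤ 1 - pw := mul_le_of_le_one_right (by linarith) hpb01
    have h2 : b ≤ pw * (1 / 2) := mul_le_mul_of_nonneg_left (by linarith) (by linarith)
    linarith
  set q := (qb * a + (1 - qw) * b) / (a + b) with hqdef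
  have hsq : (a + b) * q = qb * a + (1 - qw) * b := by
    rw [hqdef]
    field_simp
  have hsq' : (a + b) * (1 - q) = (1 - qb) * a + qw * b := by linarith
  have hq0 : 1 / 2 < q := by
    rw [hqdef, lt_div_iff₀ hab0]
    nlinarith
  have hq1 : q ≤ 1 := by
    rw [hqdef, div_le_one hab0]
    nlinarith
  obtain ⟨N, hN⟩ := exists_walkFailure_lt hm hm_odd hab0 hab1 hq0 hq1
  rw [hsq, hsq'] at hN
  have hM := majorityAccuracy_mixture_le hm_odd hb0 hba hqw0 hq hqb1
  rw [← hqdef] at hM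
  have hMq0 := majorityAccuracy_nonneg m (by linarith) hq1
  have hMq1 := majorityAccuracy_le_one hm_odd (by linarith) hq1
  -- Only the moving probability and an upper bound on `u` enter, so `N` does not depend on the
  -- labeling problem.
  have key : ∀ n, N < n → ∀ u v, 0 ≤ u → 0 ≤ v → u + v = a + b →
      u ≤ majorityAccuracy m qb * a + (1 - majorityAccuracy m qw) * b →
      1 - walkFailure u v n
        < 1 - walkFailure (qb * a + (1 - qw) * b) ((1 - qb) * a + qw * b) (m * n) := by
    intro n hn u v hu hv huv hle
    have h1 := walkFailure_anti hu hv (by linarith) (mul_nonneg hab0.le hMq0)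
      (mul_nonneg hab0.le (sub_nonneg.2 hMq1)) (by linarith) (hle.trans hM) n
    linarith [hN n hn]
  refine ⟨N, fun n hn => ⟨?_, fun {X L} _ _ P hP hbias => ?_⟩⟩
  · have hb0' := majorityAccuracy_nonneg m (q := qb) (by linarith) hqb1
    have hb1' := majorityAccuracy_le_one hm_odd (q := qb) (by linarith) hqb1
    have hw0' := majorityAccuracy_nonneg m (q := qw) (by linarith) hqw1
    have hw1' := majorityAccuracy_le_one hm_odd (q := qw) (by linarith) hqw1
    have ha0 : 0 ≤ a := by linarith
    have hu1 := add_nonneg (mul_nonneg hb0' ha0) (mul_nonneg (sub_nonneg.2 hw1') hb0)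
    have hv1 := add_nonneg (mul_nonneg (sub_nonneg.2 hb1') ha0) (mul_nonneg hw0' hb0)
    rw [sumPosProb_gapLaw hu1 hv1 (by linarith), sumPosProb_gapLaw
      (add_nonneg (mul_nonneg (by linarith) ha0) (mul_nonneg (by linarith) hb0))
      (add_nonneg (mul_nonneg (by linarith) ha0) (mul_nonneg (by linarith) hb0)) (by linarith)]
    exact key n hn _ _ hu1 hv1 (by ring) le_rfl
  · have hEb : P.dist.real P.eventB = a := hP.real_eventB hpw_ne
    have hEw : P.dist.real P.eventW = b := hP.real_eventW (by linarith)
    rw [LabelingModel.successProb_eq, LabelingModel.successProb_eq]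
    have hw : b * ∫ x, P.labelAccuracy x ∂(P.dist[|P.eventW]) = b * qw := by
      by_cases h : P.dist P.eventW = 0
      · rw [← hEw, measureReal_def, h]
        simp
      · rw [hP.qw_eq h]
    -- For one label the majority accuracy is the identity, so only the averages `qb` and `qw`
    -- survive.
    have e1 := P.real_gap_eq_one odd_one
    have e2 := P.real_gap_eq_neg_one odd_one
    simp only [majorityAccuracy_one, hEb, hEw, hP.qb_eq, mul_sub, mul_one, hw] at e1 e2
    rw [e1, e2, show a * qb + (b - b * qw) = qb * a + (1 - qw) * b by ring,
      show a - a * qb + b * qw = (1 - qb) * a + qw * b by ring]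
    refine key n hn _ _ measureReal_nonneg measureReal_nonneg ?_ ?_
    · rw [P.real_gap_eq_one hm_odd, P.real_gap_eq_neg_one hm_odd, hEb, hEw]
      ring
    · rw [P.real_gap_eq_one hm_odd, hEb, hEw]
      -- The condition is exactly the required bound on the up-probability, rearranged.
      rw [LabelingModel.NoBiasedHeterogeneity] at hbias
      linarith
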